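/- Theorem 1.4 (Audenaert–Kittaneh's conjecture). Let $\mathscr H$ be a complex separable Hilbert space. For a bounded linear operator $X$ on $\mathscr H$ and $p>0$ put $|X|=(X^*X)^{1/2}$ and $$\|X\|_p=\bigl(\operatorname{tr}|X|^p\bigr)^{1/p}\in[0,\infty],$$ where $\operatorname{tr}T=\sum_k\langle e_k,Te_k\rangle$ for a positive operator $T$ and any orthonormal basis $(e_k)$ of $\mathscr H$. Let $\mathbb B_p(\mathscr H)$ be the $p$-Schatten class, that is, the set of all compact $X$ with $\|X\|_p<\infty$. Let $p,q>0$ with $\frac1p+\frac1q=1$, and let $A_1,\dots,A_n\in\mathbb B_p(\mathscr H)$. If $1<p\le 2$, then $$\Bigl\|\sum_{i=1}^nA_i\Bigr\|_p^q+\sum_{1\le i<j\le n}\|A_i-A_j\|_p^q\le n\Bigl(\sum_{i=1}^n\|A_i\|_p^p\Bigr)^{q/p},$$ and if $p\ge 2$, then $$n\Bigl(\sum_{i=1}^n\|A_i\|_p^p\Bigr)^{q/p}\le\Bigl\|\sum_{i=1}^nA_i\Bigr\|_p^q+\sum_{1\le i<j\le n}\|A_i-A_j\|_p^q.$$ -/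

import Mathlib

open scoped ENNReal InnerProductSpace

/-- The diagonal sum of the operator `T` along the Hilbert basis `b`, as an element of `[0, ∞]`. For
positive `T` all the summands `⟪b i, T (b i)⟫` are real and nonnegative. -/
noncomputable def diagSum {H ι : Type*} [NormedAddCommGroup H] [InnerProductSpace ℂ H]
    (b : HilbertBasis ι ℂ H) (T : H →L[ℂ] H) : ℝ≥0∞ :=
  ∑' i, ENNReal.ofReal (⟪b i, T (b i)⟫_ℂ).re

/-- The trace, with values in `[0, ∞]`, of a positive operator: its diagonal sum along a Hilbert
basis. It does not depend on the basis, see `posTrace_eq_diagSum`. -/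
noncomputable def posTrace {H : Type*} [NormedAddCommGroup H] [InnerProductSpace ℂ H]
    [CompleteSpace H] (T : H →L[ℂ] H) : ℝ≥0∞ :=
  diagSum (exists_hilbertBasis ℂ H).choose_spec.choose T

theorem parseval_ennreal {H ι : Type*} [NormedAddCommGroup H] [InnerProductSpace ℂ H]
    (b : HilbertBasis ι ℂ H) (x : H) :
    ∑' i, ENNReal.ofReal (‖⟪b i, x⟫_ℂ‖ ^ 2) = ENNReal.ofReal (‖x‖ ^ 2) := by
  have h := (b.hasSum_inner_mul_inner x x).mapL Complex.reCLM
  have e : (fun i => Complex.reCLM (⟪x, b i⟫_ℂ * ⟪b i, x⟫_ℂ)) =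
      fun i => ‖⟪b i, x⟫_ℂ‖ ^ 2 := by
    funext i
    rw [← inner_conj_symm x (b i), ← Complex.normSq_eq_conj_mul_self, Complex.normSq_eq_norm_sq]
    simp only [Complex.reCLM_apply, Complex.ofReal_re]
  rw [e] at h
  have h2 : Complex.reCLM ⟪x, x⟫_ℂ = ‖x‖ ^ 2 := by
    rw [inner_self_eq_norm_sq_to_K]
    simp [← Complex.ofReal_pow]
  rw [h2] at h
  rw [← ENNReal.ofReal_tsum_of_nonneg (fun i => by positivity) h.summable, h.tsum_eq]

/-- The diagonal sum of a positive operator is the same for any two Hilbert bases. -/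
theorem diagSum_eq_diagSum {H ι κ : Type*} [NormedAddCommGroup H] [InnerProductSpace ℂ H]
    [CompleteSpace H] (b : HilbertBasis ι ℂ H) (c : HilbertBasis κ ℂ H) (T : H →L[ℂ] H)
    (hT : 0 ≤ T) : diagSum b T = diagSum c T := by
  obtain ⟨S, hS, hST⟩ : ∃ S : H →L[ℂ] H, IsSelfAdjoint S ∧ S * S = T :=
    ⟨CFC.sqrt T, (CFC.sqrt_nonneg T).isSelfAdjoint, CFC.sqrt_mul_sqrt_self T⟩
  have hsym : ∀ x y : H, ⟪S x, y⟫_ℂ = ⟪x, S y⟫_ℂ := fun x y =>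
    (ContinuousLinearMap.isSelfAdjoint_iff_isSymmetric.mp hS) x y
  have key : ∀ x : H, (⟪x, T x⟫_ℂ).re = ‖S x‖ ^ 2 := fun x => by
    rw [← hST, mul_apply_eq_comp, ← hsym, inner_self_eq_norm_sq_to_K]
    simp [← Complex.ofReal_pow]
  simp only [diagSum, key]
  calc ∑' i, ENNReal.ofReal (‖S (b i)‖ ^ 2)
      = ∑' i, ∑' j, ENNReal.ofReal (‖⟪c j, S (b i)⟫_ℂ‖ ^ 2) := by
        simp only [parseval_ennreal]
    _ = ∑' j, ∑' i, ENNReal.ofReal (‖⟪c j, S (b i)⟫_ℂ‖ ^ 2) := ENNReal.tsum_comm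
    _ = ∑' j, ∑' i, ENNReal.ofReal (‖⟪b i, S (c j)⟫_ℂ‖ ^ 2) := by
        simp only [fun i j => (norm_inner_symm (c j) (S (b i))).trans
          (congrArg norm (hsym (b i) (c j)))]
    _ = ∑' j, ENNReal.ofReal (‖S (c j)‖ ^ 2) := by
        simp only [parseval_ennreal]

theorem posTrace_eq_diagSum {H ι : Type*} [NormedAddCommGroup H] [InnerProductSpace ℂ H]
    [CompleteSpace H] (b : HilbertBasis ι ℂ H) (T : H →L[ℂ] H) (hT : 0 ≤ T) :
    posTrace T = diagSum b T :=
  diagSum_eq_diagSum _ b T hT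

/-- The Schatten norm `‖X‖_p = (tr |X|^p)^(1/p)` in `[0, ∞]`, for `p > 0`. Here `|X|` is the square
root of `X* X`, and `|X|^p` is given by the functional calculus. -/
noncomputable def schattenNorm {H : Type*} [NormedAddCommGroup H] [InnerProductSpace ℂ H]
    [CompleteSpace H] (p : ℝ) (X : H →L[ℂ] H) : ℝ≥0∞ :=
  posTrace (CFC.abs X ^ p) ^ (1 / p)

/-- The Schatten class of compact operators `X` with `‖X‖_p < ∞`. -/
def schattenClass (H : Type*) [NormedAddCommGroup H] [InnerProductSpace ℂ H]
    [CompleteSpace H] (p : ℝ) : Set (H →L[ℂ] H) :=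
  {X | IsCompactOperator X ∧ schattenNorm p X < ∞}

-- The sum and the differences are the images of `(A_i)` under a real matrix `T`, `sumDiffMatrix`.
-- Only two of its properties matter: its entries have absolute value at most 1, and `TᵀT = n`. Put
-- `B_l = ∑ i, T l i • A i`. By the first property, `A ↦ B` has norm at most 1 from `ℓ¹(S_1)` to
-- `ℓ^∞(S_1)`; by the second, it has norm `√n` from `ℓ²(S_2)` to `ℓ²(S_2)`. Interpolation at `θ =
-- 2/q` gives norm at most `n^(1/q)` from `ℓ^p(S_p)` to `ℓ^q(S_p)`, which is the case `p ≤ 2`. The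
-- case `p ≥ 2` is dual to it.
--
-- No interpolation of operator spaces is needed. Once the singular vectors of all `A_i` and `B_l`
-- are fixed, the pairing `∑ c ⟪h, B g⟫` is a bilinear form in scalar families `c`, `d` with a fixed
-- kernel. `norm_sum_kernel_le` bounds such a form by the three lines theorem, and
-- `norm_sum_matrixCoeff_le` verifies the two endpoint estimates.
--
-- For `p ≤ 2`, `d` consists of the singular values of the `A_i` and `c` is a norming functional for
-- `B` (`sum_schatten_rpow_le`). For `p ≥ 2` the same bound is used with `p` and `q` exchanged: `c`
-- consists of the singular values of the `B_l`, `d` is a norming functional for `A`, and `TᵀT = n`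
-- recovers `A` from `B` (`le_sum_schatten_rpow`).

universe u

/-! ### Schmidt decomposition of compact operators -/

section Schmidt

open scoped ComplexOrder

variable {H : Type u} [NormedAddCommGroup H] [InnerProductSpace ℂ H]

theorem aeval_apply_of_apply_eq_smul {T : H →L[ℂ] H} {x : H} {r : ℝ} (h : T x = (r : ℂ) • x)
    (P : Polynomial ℝ) : Polynomial.aeval T P x = ((P.eval r : ℝ) : ℂ) • x := by
  induction P using Polynomial.induction_on' with
  | add P Q hP hQ => simp [hP, hQ, add_smul]
  | monomial n a =>
    have hpow : ∀ m : ℕ, (T ^ m) x = ((r : ℂ) ^ m) • x := by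
      intro m
      induction m with
      | zero => simp
      | succ m ih => rw [pow_succ', mul_apply_eq_comp, ih, map_smul, h, smul_smul, pow_succ]
    rw [Polynomial.aeval_monomial, mul_apply_eq_comp, hpow, Polynomial.eval_monomial,
      Algebra.algebraMap_eq_smul_one, smul_apply, one_apply_eq_self, Complex.ofReal_mul,
      Complex.ofReal_pow, mul_smul, Complex.coe_smul]

/-- Clear for polynomials; the general case follows by Weierstrass approximation. -/
theorem cfc_apply_of_apply_eq_smul [CompleteSpace H] {T : H →L[ℂ] H} (hT : IsSelfAdjoint T) {x : H}
    {r : ℝ} (h : T x = (r : ℂ) • x) {f : ℝ → ℝ} (hf : Continuous f) :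
    cfc f T x = ((f r : ℝ) : ℂ) • x := by
  -- The interval must contain `r` as well as the spectrum, since `r` is arbitrary when `x = 0`.
  set R := max |r| (‖T‖ * ‖(1 : H →L[ℂ] H)‖)
  have hb : ∀ ε > 0, ‖cfc f T x - ((f r : ℝ) : ℂ) • x‖ ≤ ε * (2 * ‖x‖) := by
    intro ε hε
    obtain ⟨P, hP⟩ := exists_polynomial_near_of_continuousOn (-R) R f hf.continuousOn ε hε
    have h1 : ‖cfc f T - cfc P.eval T‖ ≤ ε := by
      rw [← cfc_sub f P.eval T hf.continuousOn P.continuous.continuousOn]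
      refine norm_cfc_le hε.le fun y hy => ?_
      have hy' : |y| ≤ R := (spectrum.norm_le_norm_mul_of_mem hy).trans (le_max_right _ _)
      rw [Real.norm_eq_abs, abs_sub_comm]
      exact (hP y (abs_le.mp hy')).le
    have h2 : cfc P.eval T x = ((P.eval r : ℝ) : ℂ) • x := by
      rw [cfc_polynomial P T hT, aeval_apply_of_apply_eq_smul h]
    have e : cfc f T x - ((f r : ℝ) : ℂ) • x
        = (cfc f T - cfc P.eval T) x + (((P.eval r - f r : ℝ) : ℂ)) • x := by
      rw [sub_apply, h2]
      push_cast
      module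
    rw [e]
    refine (norm_add_le _ _).trans ?_
    rw [norm_smul, Complex.norm_real, Real.norm_eq_abs]
    have h3 := (hP r (abs_le.mp (le_max_left _ _))).le
    have h4 := ((cfc f T - cfc P.eval T).le_opNorm x).trans
      (mul_le_mul_of_nonneg_right h1 (norm_nonneg x))
    have h5 := mul_le_mul_of_nonneg_right h3 (norm_nonneg x)
    linarith
  rw [← sub_eq_zero, ← norm_le_zero_iff]
  refine le_of_forall_pos_le_add fun δ hδ => ?_
  refine (hb (δ / (2 * ‖x‖ + 1)) (by positivity)).trans ?_
  rw [zero_add, div_mul_eq_mul_div, div_le_iff₀ (by positivity)]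
  nlinarith

/-- The eigenspaces are mutually orthogonal and, by compactness, span a dense subspace, so Hilbert
bases of the eigenspaces combine to one of `H`. -/
theorem exists_hilbertBasis_eigenvectors [CompleteSpace H] {T : H →L[ℂ] H} (hT : 0 ≤ T)
    (hc : IsCompactOperator T) :
    ∃ (ι : Type u) (b : HilbertBasis ι ℂ H) (r : ι → ℝ), ∀ i, 0 ≤ r i ∧ T (b i) = (r i : ℂ) • b i := by
  have hpos : T.IsPositive := (ContinuousLinearMap.nonneg_iff_isPositive T).mp hT
  have hsym : T.IsSymmetric := hpos.isSymmetric
  let V : ℂ → Submodule ℂ H := fun μ => Module.End.eigenspace (T : Module.End ℂ H) μ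
  have hcl : ∀ μ, IsClosed (V μ : Set H) := by
    intro μ
    have : (V μ : Set H) = {x | T x = μ • x} := by
      ext x
      simp [V]
    rw [this]
    exact isClosed_eq T.continuous (continuous_const_smul μ)
  have : ∀ μ, CompleteSpace (V μ) := fun μ => (hcl μ).completeSpace_coe
  choose w b hb using fun μ => exists_hilbertBasis ℂ (V μ)
  have hV : OrthogonalFamily ℂ (fun μ => V μ) fun μ => (V μ).subtypeₗᵢ :=
    hsym.orthogonalFamily_eigenspaces
  have hv := hV.orthonormal_sigma_orthonormal (fun μ => (b μ).orthonormal)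
  refine ⟨_, HilbertBasis.mkOfOrthogonalEqBot hv ?_, fun a => a.1.re, ?_⟩
  · rw [Submodule.eq_bot_iff]
    intro x hx
    have hx' : ∀ a : Σ μ, w μ, ⟪((b a.1 a.2 : V a.1) : H), x⟫_ℂ = 0 := fun a =>
      (Submodule.mem_orthogonal _ _).mp hx _ (Submodule.subset_span ⟨a, rfl⟩)
    have hy : ∀ μ, ∀ y : V μ, ⟪(y : H), x⟫_ℂ = 0 := by
      intro μ y
      have h := (((b μ).hasSum_repr y).mapL (V μ).subtypeL).mapL (innerSL ℂ x)
      have hz : ∀ i, ⟪x, ((b μ i : V μ) : H)⟫_ℂ = 0 := fun i =>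
        inner_eq_zero_symm.mp (hx' ⟨μ, i⟩)
      simp only [map_smul, Submodule.subtypeL_apply, innerSL_apply_apply, hz, smul_zero] at h
      exact inner_eq_zero_symm.mp (h.unique hasSum_zero)
    have hbot := ContinuousLinearMap.orthogonalComplement_iSup_eigenspaces_eq_bot hc hsym
    rw [← Submodule.mem_bot ℂ, ← hbot, ← Submodule.iInf_orthogonal, Submodule.mem_iInf]
    exact fun μ => (Submodule.mem_orthogonal _ _).mpr fun y hym => hy μ ⟨y, hym⟩
  · rw [HilbertBasis.coe_mkOfOrthogonalEqBot]
    rintro ⟨μ, i⟩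
    have hx : T ((b μ i : V μ) : H) = μ • ((b μ i : V μ) : H) :=
      Module.End.mem_eigenspace_iff.mp (b μ i).2
    have hn : ‖((b μ i : V μ) : H)‖ = 1 := (b μ).orthonormal.1 i
    have hi : ⟪((b μ i : V μ) : H), T ((b μ i : V μ) : H)⟫_ℂ = μ := by
      rw [hx, inner_smul_right, inner_self_eq_norm_sq_to_K, hn]
      simp
    have h0 : 0 ≤ μ := by
      rw [← hi]
      exact hpos.inner_nonneg_right _
    have hre : ((μ.re : ℝ) : ℂ) = μ := (Complex.eq_re_of_ofReal_le h0).symm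
    exact ⟨(Complex.nonneg_iff.mp h0).1, by simpa [hre] using hx⟩

theorem posTrace_abs_rpow [CompleteSpace H] {X : H →L[ℂ] H} {ι : Type*} (b : HilbertBasis ι ℂ H)
    {r : ι → ℝ} (hb : ∀ i, (star X * X) (b i) = (r i : ℂ) • b i) {p : ℝ}
    (hp : 0 < p) : posTrace (CFC.abs X ^ p) = ∑' i, ENNReal.ofReal (r i ^ (p / 2)) := by
  rw [posTrace_eq_diagSum b _ CFC.rpow_nonneg]
  refine tsum_congr fun i => ?_
  have h0 : 0 ≤ star X * X := star_mul_self_nonneg X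
  have e : CFC.abs X ^ p = cfc (fun x : ℝ => x ^ (p / 2)) (star X * X) := by
    rw [CFC.abs, CFC.sqrt_eq_rpow, CFC.rpow_rpow_of_exponent_nonneg _ _ _ (by norm_num) hp.le,
      CFC.rpow_eq_cfc_real]
    congr! 3
    ring
  rw [e, cfc_apply_of_apply_eq_smul h0.isSelfAdjoint (hb i)
    (Real.continuous_rpow_const (by positivity)), inner_smul_right, inner_self_eq_norm_sq_to_K,
    b.orthonormal.1 i]
  simp

/-- The singular value decomposition of a compact operator. -/
theorem IsCompactOperator.exists_schmidt [CompleteSpace H] {X : H →L[ℂ] H}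
    (hX : IsCompactOperator X) :
    ∃ (κ : Type u) (s : κ → ℝ) (e f : κ → H), (∀ k, 0 < s k) ∧ Orthonormal ℂ e ∧ Orthonormal ℂ f ∧
      (∀ x, HasSum (fun k => ((s k : ℂ) * ⟪e k, x⟫_ℂ) • f k) (X x)) ∧
      ∀ p : ℝ, 0 < p → posTrace (CFC.abs X ^ p) = ∑' k, ENNReal.ofReal (s k ^ p) := by
  have h0 : 0 ≤ star X * X := star_mul_self_nonneg X
  obtain ⟨ι, b, r, hr⟩ := exists_hilbertBasis_eigenvectors h0 (hX.clm_comp (star X))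
  have hXX : ∀ i j, ⟪X (b i), X (b j)⟫_ℂ = (r j : ℂ) * ⟪b i, b j⟫_ℂ := by
    intro i j
    rw [← inner_smul_right, ← (hr j).2, mul_apply_eq_comp, ContinuousLinearMap.star_eq_adjoint,
      ContinuousLinearMap.adjoint_inner_right]
  have hX0 : ∀ i, r i = 0 → X (b i) = 0 := by
    intro i hi
    rw [← inner_self_eq_zero (𝕜 := ℂ), hXX, hi]
    simp
  have hpos : ∀ k : {i // r i ≠ 0}, 0 < r k := fun k => (hr k).1.lt_of_ne' k.2
  -- The singular values are the square roots of the nonzero eigenvalues of `X* X`, and the left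
  -- singular vectors are the normalized images `X e / s`. Eigenvectors for the eigenvalue 0 lie in
  -- the kernel of `X`, so omitting them changes no sum.
  refine ⟨{i // r i ≠ 0}, fun k => √(r k), fun k => b k,
    fun k => ((√(r k) : ℝ) : ℂ)⁻¹ • X (b k), fun k => Real.sqrt_pos.mpr (hpos k),
    b.orthonormal.comp _ Subtype.val_injective, ?_, ?_, ?_⟩
  · classical
    rw [orthonormal_iff_ite]
    intro k l
    rw [inner_smul_left, inner_smul_right, hXX, orthonormal_iff_ite.mp b.orthonormal]
    by_cases h : k = l
    · subst h
      have h1 : ((√(r k) : ℝ) : ℂ) ≠ 0 := by exact_mod_cast (Real.sqrt_pos.mpr (hpos k)).ne'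
      have h2 : (r k : ℂ) = ((√(r k) : ℝ) : ℂ) * ((√(r k) : ℝ) : ℂ) := by
        exact_mod_cast (Real.mul_self_sqrt (hr k).1).symm
      simp only [if_true, map_inv₀, Complex.conj_ofReal]
      rw [h2]
      field_simp
    · simp [h, Subtype.val_injective.ne h]
  · intro x
    have h := (b.hasSum_repr x).mapL X
    have hs : Function.support (fun i => X (b.repr x i • b i)) ⊆ {i | r i ≠ 0} := by
      intro i hi h'
      apply hi
      simp [hX0 i h']
    have h' : HasSum (fun k : {i // r i ≠ 0} => X (b.repr x k • b k)) (X x) :=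
      (hasSum_subtype_iff_of_support_subset hs).mpr h
    refine (congrArg (HasSum · (X x)) (funext fun k => ?_)).mp h'
    have h1 : ((√(r k) : ℝ) : ℂ) ≠ 0 := by exact_mod_cast (Real.sqrt_pos.mpr (hpos k)).ne'
    rw [map_smul, smul_smul, b.repr_apply_apply]
    congr 1
    field_simp
  · intro p hp
    rw [posTrace_abs_rpow b (fun i => (hr i).2) hp]
    have hs : Function.support (fun i => ENNReal.ofReal (r i ^ (p / 2))) ⊆ {i | r i ≠ 0} := by
      intro i hi h'
      apply hi
      simp only [h']
      rw [Real.zero_rpow (by positivity), ENNReal.ofReal_zero]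
    rw [← tsum_subtype_eq_of_support_subset hs]
    refine tsum_congr fun k => ?_
    change _ = ENNReal.ofReal (√(r k) ^ p)
    rw [Real.sqrt_eq_rpow, ← Real.rpow_mul (hpos k).le]
    congr 2
    ring

end Schmidt

/-! ### Interpolation for scalar kernels -/

section Interpolation

theorem norm_ofReal_cpow {x : ℝ} (hx : 0 < x) (w : ℂ) : ‖(x : ℂ) ^ w‖ = x ^ w.re :=
  Complex.norm_cpow_eq_rpow_re_of_pos hx w

theorem differentiable_ofReal_cpow {x : ℝ} (hx : 0 < x) {g : ℂ → ℂ} (hg : Differentiable ℂ g) :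
    Differentiable ℂ fun z => (x : ℂ) ^ g z := fun z =>
  (hg z).const_cpow (Or.inl (by exact_mod_cast hx.ne'))

/-- Riesz–Thorin interpolation between `ℓ¹ → ℓ^∞(ℓ¹)` and `ℓ² → ℓ²(ℓ²)`, in dual form. -/
theorem norm_sum_kernel_le {L α : Type*} [Fintype L] [Fintype α] {μ : L → Type*}
    [∀ l, Fintype (μ l)] (K : ∀ l, μ l → α → ℂ) {N : ℝ} (hN : 0 ≤ N)
    (h1 : ∀ l a, ∑ m, ‖K l m a‖ ≤ 1)
    (h2 : ∀ (c : ∀ l, μ l → ℂ) (d : α → ℂ), ‖∑ l, ∑ m, ∑ a, c l m * K l m a * d a‖ ≤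
      √(N * (∑ l, ∑ m, ‖c l m‖ ^ 2) * ∑ a, ‖d a‖ ^ 2))
    {p q : ℝ} (hp : 1 < p) (hp2 : p ≤ 2) (hpq : 1 / p + 1 / q = 1) (hq : 0 < q)
    {c : ∀ l, μ l → ℝ} (hc : ∀ l m, 0 < c l m) {d : α → ℝ} (hd : ∀ a, 0 < d a) :
    ‖∑ l, ∑ m, ∑ a, (c l m : ℂ) * K l m a * d a‖ ≤
      N ^ (1 / q) * (∑ a, d a ^ p) ^ (1 / p) * (∑ l, (∑ m, c l m ^ q) ^ (p / q)) ^ (1 / p) := by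
  have hp0 : 0 < p := by linarith
  have hpq' : p + q = p * q := by field_simp at hpq; linarith
  have hq2 : 2 ≤ q := by nlinarith
  set C : L → ℝ := fun l => (∑ m, c l m ^ q) ^ (1 / q) with hC
  have hcq : ∀ l, 0 ≤ ∑ m, c l m ^ q := fun l =>
    Finset.sum_nonneg fun m _ => Real.rpow_nonneg (hc l m).le _
  have hC0 : ∀ l, 0 ≤ C l := fun l => Real.rpow_nonneg (hcq l) _
  have hcC : ∀ l m, c l m ≤ C l := by
    intro l m
    have h0 : c l m ^ q ≤ ∑ m, c l m ^ q := Finset.single_le_sum (f := fun m => c l m ^ q)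
      (fun m _ => Real.rpow_nonneg (hc l m).le _) (Finset.mem_univ m)
    have h := Real.rpow_le_rpow (Real.rpow_nonneg (hc l m).le q) h0 (one_div_nonneg.mpr hq.le)
    rwa [← Real.rpow_mul (hc l m).le, mul_one_div_cancel hq.ne', Real.rpow_one] at h
  -- `C l` is zero when `μ l` is empty, so positivity requires an index `m`.
  have hCpos : ∀ l, μ l → 0 < C l := fun l m => (hc l m).trans_le (hcC l m)
  have hCq : ∀ l, C l ^ q = ∑ m, c l m ^ q := fun l => by
    rw [hC, ← Real.rpow_mul (hcq l), one_div_mul_cancel hq.ne', Real.rpow_one]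
  have hCp : ∀ l, C l ^ p = (∑ m, c l m ^ q) ^ (p / q) := fun l => by
    rw [hC, ← Real.rpow_mul (hcq l)]
    congr 1
    ring
  simp_rw [← hCp]
  set S := ∑ l, C l ^ p with hS
  set D := ∑ a, d a ^ p with hD
  have hS0 : 0 ≤ S := Finset.sum_nonneg fun l _ => Real.rpow_nonneg (hC0 l) _
  have hD0 : 0 ≤ D := Finset.sum_nonneg fun a _ => Real.rpow_nonneg (hd a).le _
  -- The exponents are affine in `z`. At `z = 2 / q` they give back `c` and `d`, because `p + q = p
  -- * q`. On `re z = 0` the moduli are `C l ^ p` and `d a ^ p`; on `re z = 1` their squares sum to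
  -- at most `S` and exactly `D`.
  let cz : ℂ → ∀ l, μ l → ℂ := fun z l m =>
    (C l : ℂ) ^ ((p : ℂ) - z * ((p + q : ℝ) / 2 : ℝ)) * (c l m : ℂ) ^ (z * (q / 2 : ℝ))
  let dz : ℂ → α → ℂ := fun z a => (d a : ℂ) ^ ((p : ℂ) - z * (p / 2 : ℝ))
  let F : ℂ → ℂ := fun z => ∑ l, ∑ m, ∑ a, cz z l m * K l m a * dz z a
  have hcz : ∀ z l m, ‖cz z l m‖ = C l ^ (p - z.re * ((p + q) / 2)) * c l m ^ (z.re * (q / 2)) := by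
    intro z l m
    rw [norm_mul, norm_ofReal_cpow (hCpos l m), norm_ofReal_cpow (hc l m), Complex.sub_re,
      Complex.re_mul_ofReal, Complex.re_mul_ofReal, Complex.ofReal_re]
  have hdz : ∀ z a, ‖dz z a‖ = d a ^ (p - z.re * (p / 2)) := by
    intro z a
    rw [norm_ofReal_cpow (hd a), Complex.sub_re, Complex.re_mul_ofReal, Complex.ofReal_re]
  have hF : Differentiable ℂ F := by
    refine Differentiable.fun_sum fun l _ => Differentiable.fun_sum fun m _ =>
      Differentiable.fun_sum fun a _ => ?_
    refine (((differentiable_ofReal_cpow (hCpos l m) ?_).mul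
      (differentiable_ofReal_cpow (hc l m) ?_)).mul_const _).mul
      (differentiable_ofReal_cpow (hd a) ?_) <;> fun_prop
  have hFle : ∀ z, ‖F z‖ ≤ ∑ l, ∑ m, ∑ a, ‖cz z l m‖ * ‖K l m a‖ * ‖dz z a‖ := by
    intro z
    refine (norm_sum_le _ _).trans (Finset.sum_le_sum fun l _ => ?_)
    refine (norm_sum_le _ _).trans (Finset.sum_le_sum fun m _ => ?_)
    refine (norm_sum_le _ _).trans (Finset.sum_le_sum fun a _ => ?_)
    rw [norm_mul, norm_mul]
  -- The bound `hFle` depends only on `re z`, continuously, and `re z` ranges over a compact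
  -- interval.
  have hB : BddAbove ((norm ∘ F) '' Complex.HadamardThreeLines.verticalClosedStrip 0 1) := by
    let G : ℝ → ℝ := fun x => ∑ l, ∑ m, ∑ a, C l ^ (p - x * ((p + q) / 2)) * c l m ^ (x * (q / 2)) *
      ‖K l m a‖ * d a ^ (p - x * (p / 2))
    have hG : Continuous G := by
      refine continuous_finsetSum _ fun l _ => continuous_finsetSum _ fun m _ =>
        continuous_finsetSum _ fun a _ => ?_
      refine (((Continuous.rpow continuous_const ?_ fun _ => Or.inl (hCpos l m).ne').mul
        (Continuous.rpow continuous_const ?_ fun _ => Or.inl (hc l m).ne')).mul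
          continuous_const).mul
        (Continuous.rpow continuous_const ?_ fun _ => Or.inl (hd a).ne') <;> fun_prop
    obtain ⟨M, hM⟩ := (isCompact_Icc (a := (0 : ℝ)) (b := 1)).bddAbove_image hG.continuousOn
    refine ⟨M, ?_⟩
    rintro _ ⟨z, hz, rfl⟩
    refine (hFle z).trans ?_
    simp only [hcz, hdz]
    exact hM ⟨z.re, hz, rfl⟩
  have hb0 : ∀ z ∈ Complex.re ⁻¹' {(0 : ℝ)}, ‖F z‖ ≤ S * D := by
    intro z hz
    have hz : z.re = 0 := hz
    refine (hFle z).trans ?_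
    simp only [hcz, hdz, hz, zero_mul, sub_zero, Real.rpow_zero, mul_one]
    rw [hS, Finset.sum_mul]
    refine Finset.sum_le_sum fun l _ => ?_
    rw [Finset.sum_comm, hD, Finset.mul_sum]
    refine Finset.sum_le_sum fun a _ => ?_
    rw [← Finset.sum_mul, ← Finset.mul_sum]
    refine mul_le_mul_of_nonneg_right ?_ (Real.rpow_nonneg (hd a).le _)
    exact mul_le_of_le_one_right (Real.rpow_nonneg (hC0 l) _) (h1 l a)
  have hb1 : ∀ z ∈ Complex.re ⁻¹' {(1 : ℝ)}, ‖F z‖ ≤ √(N * S * D) := by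
    intro z hz
    have hz : z.re = 1 := hz
    refine (h2 (cz z) (dz z)).trans (Real.sqrt_le_sqrt ?_)
    have e1 : ∑ a, ‖dz z a‖ ^ 2 = D := by
      refine Finset.sum_congr rfl fun a _ => ?_
      rw [hdz, hz, ← Real.rpow_mul_natCast (hd a).le]
      congr 1
      push_cast
      ring
    have e2 : ∑ l, ∑ m, ‖cz z l m‖ ^ 2 ≤ S := by
      refine Finset.sum_le_sum fun l _ => ?_
      have e3 : ∀ m, ‖cz z l m‖ ^ 2 = C l ^ (p - q) * c l m ^ q := by
        intro m
        rw [hcz, hz, mul_pow, ← Real.rpow_mul_natCast (hC0 l), ← Real.rpow_mul_natCast (hc l m).le]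
        congr 2 <;> push_cast <;> ring
      simp only [e3]
      rw [← Finset.mul_sum, ← hCq]
      rcases (hC0 l).eq_or_lt with h | h
      · rw [← h, Real.zero_rpow hq.ne', mul_zero]
        exact Real.rpow_nonneg le_rfl _
      · rw [← Real.rpow_add h, sub_add_cancel]
    rw [e1]
    gcongr
  have hq1 : 2 / q ≤ 1 := (div_le_one hq).mpr hq2
  have key := Complex.HadamardThreeLines.norm_le_interp_of_mem_verticalClosedStrip'
    (f := F) (z := ((2 / q : ℝ) : ℂ)) zero_lt_one ⟨by simp; positivity, by simpa using hq1⟩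
    hF.diffContOnCl hB hb0 hb1
  have hFθ : F ((2 / q : ℝ) : ℂ) = ∑ l, ∑ m, ∑ a, (c l m : ℂ) * K l m a * d a := by
    refine Finset.sum_congr rfl fun l _ => Finset.sum_congr rfl fun m _ =>
      Finset.sum_congr rfl fun a _ => ?_
    have x1 : (p : ℂ) - ((2 / q : ℝ) : ℂ) * ((p + q : ℝ) / 2 : ℝ) = 0 := by
      rw [hpq', ← Complex.ofReal_mul, ← Complex.ofReal_sub, Complex.ofReal_eq_zero]
      field_simp
      ring
    have x2 : ((2 / q : ℝ) : ℂ) * (q / 2 : ℝ) = 1 := by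
      rw [← Complex.ofReal_mul, Complex.ofReal_eq_one]
      field_simp
    have x3 : (p : ℂ) - ((2 / q : ℝ) : ℂ) * (p / 2 : ℝ) = 1 := by
      rw [← Complex.ofReal_mul, ← Complex.ofReal_sub, Complex.ofReal_eq_one]
      field_simp
      linarith
    simp only [cz, dz, x1, x2, x3, Complex.cpow_zero, Complex.cpow_one, one_mul]
  rw [hFθ, Complex.ofReal_re, sub_zero, sub_zero, div_one] at key
  refine key.trans_eq ?_
  have ep : 1 / p = (1 - 2 / q) + 1 / q := by
    have : 1 / p = 1 - 1 / q := by linarith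
    rw [this]
    ring
  have en : 0 ≤ 1 - 2 / q := by linarith
  have eq0 : 0 ≤ 1 / q := by positivity
  rw [Real.sqrt_eq_rpow, ← Real.rpow_mul (by positivity), show 1 / 2 * (2 / q) = 1 / q by ring,
    Real.mul_rpow (mul_nonneg hN hS0) hD0, Real.mul_rpow hN hS0, Real.mul_rpow hS0 hD0, ep,
    Real.rpow_add_of_nonneg hS0 en eq0, Real.rpow_add_of_nonneg hD0 en eq0]
  ring

end Interpolation

/-! ### The two endpoint estimates for the kernel of matrix coefficients -/

section Kernel

variable {H : Type*} [NormedAddCommGroup H] [InnerProductSpace ℂ H]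
  {L I : Type*} [Fintype L] [Fintype I] [DecidableEq I]

/-- Expanding the squares leaves only the diagonal terms, as the columns of `T` are orthogonal. -/
theorem sum_norm_sq_sum_smul {T : L → I → ℝ} {N : ℝ}
    (hT : ∀ i j, ∑ l, T l i * T l j = if i = j then N else 0) (u : I → H) :
    ∑ l, ‖∑ i, (T l i : ℂ) • u i‖ ^ 2 = N * ∑ i, ‖u i‖ ^ 2 := by
  have h : ∀ x : H, ((‖x‖ ^ 2 : ℝ) : ℂ) = ⟪x, x⟫_ℂ := fun x => by
    rw [inner_self_eq_norm_sq_to_K]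
    push_cast
    rfl
  have hc : ∑ l, ⟪∑ i, (T l i : ℂ) • u i, ∑ i, (T l i : ℂ) • u i⟫_ℂ = N * ∑ i, ⟪u i, u i⟫_ℂ := by
    calc ∑ l, ⟪∑ i, (T l i : ℂ) • u i, ∑ i, (T l i : ℂ) • u i⟫_ℂ
        = ∑ l, ∑ i, ∑ j, ((T l i * T l j : ℝ) : ℂ) * ⟪u i, u j⟫_ℂ := by
          simp only [sum_inner, inner_sum, inner_smul_left, inner_smul_right, Complex.conj_ofReal,
            Complex.ofReal_mul, Finset.mul_sum]
          refine Finset.sum_congr rfl fun l _ => ?_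
          rw [Finset.sum_comm]
          refine Finset.sum_congr rfl fun i _ => Finset.sum_congr rfl fun j _ => ?_
          ring
      _ = ∑ i, ∑ j, ((∑ l, T l i * T l j : ℝ) : ℂ) * ⟪u i, u j⟫_ℂ := by
          rw [Finset.sum_comm]
          refine Finset.sum_congr rfl fun i _ => ?_
          rw [Finset.sum_comm]
          refine Finset.sum_congr rfl fun j _ => ?_
          rw [← Finset.sum_mul, Complex.ofReal_sum]
      _ = _ := by
          simp [hT, Finset.mul_sum, apply_ite]
  simp only [← h] at hc
  exact_mod_cast hc

variable {ι : I → Type*} {κ : L → Type*} [∀ i, Fintype (ι i)] [∀ l, Fintype (κ l)]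

/-- The Hilbert–Schmidt bound for the matrix coefficients of the operators
`∑ i, T l i • ∑ k, d i k • ⟪e i k, ·⟫ f i k`. -/
theorem sum_norm_sq_matrixCoeff_le [CompleteSpace H] {T : L → I → ℝ} {N : ℝ} (hN : 0 ≤ N)
    (hT : ∀ i j, ∑ l, T l i * T l j = if i = j then N else 0)
    {e f : ∀ i, ι i → H} {g h : ∀ l, κ l → H} (he : ∀ i, Orthonormal ℂ (e i))
    (hf : ∀ i, Orthonormal ℂ (f i)) (hg : ∀ l, Orthonormal ℂ (g l))
    (hh : ∀ l, Orthonormal ℂ (h l)) (d : ∀ i, ι i → ℂ) :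
    ∑ l, ∑ m, ‖∑ i, ∑ k, (T l i : ℂ) * (⟪h l m, f i k⟫_ℂ * ⟪e i k, g l m⟫_ℂ) * d i k‖ ^ 2 ≤
      N * ∑ i, ∑ k, ‖d i k‖ ^ 2 := by
  obtain ⟨w, b, -⟩ := exists_hilbertBasis ℂ H
  -- With `D_i = ∑ k, d i k • ⟪e i k, ·⟫ f i k`, `u x i` is `D_i* x` and `v l m` is `(∑ i, T l i •
  -- D_i) (g l m)`.
  let u : H → I → H := fun x i => ∑ k, (starRingEnd ℂ (d i k) * ⟪f i k, x⟫_ℂ) • e i k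
  let v : ∀ l, κ l → H := fun l m => ∑ i, ∑ k, ((T l i : ℂ) * ⟪e i k, g l m⟫_ℂ * d i k) • f i k
  have h1 : ∀ l m, ∑ i, ∑ k, (T l i : ℂ) * (⟪h l m, f i k⟫_ℂ * ⟪e i k, g l m⟫_ℂ) * d i k =
      ⟪h l m, v l m⟫_ℂ := by
    intro l m
    simp only [v, inner_sum, inner_smul_right]
    refine Finset.sum_congr rfl fun i _ => Finset.sum_congr rfl fun k _ => ?_
    ring
  have h2 : ∀ x l m, ⟪∑ i, (T l i : ℂ) • u x i, g l m⟫_ℂ = ⟪x, v l m⟫_ℂ := by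
    intro x l m
    simp only [u, v, inner_sum, sum_inner, inner_smul_right, inner_smul_left, Complex.conj_ofReal,
      map_mul, Complex.conj_conj, inner_conj_symm, Finset.mul_sum]
    refine Finset.sum_congr rfl fun i _ => Finset.sum_congr rfl fun k _ => ?_
    ring
  have h3 : ∀ x i, ‖u x i‖ ^ 2 = ∑ k, ‖d i k‖ ^ 2 * ‖⟪f i k, x⟫_ℂ‖ ^ 2 := by
    intro x i
    rw [← Complex.ofReal_inj]
    have h := (he i).inner_sum (fun k => starRingEnd ℂ (d i k) * ⟪f i k, x⟫_ℂ)
      (fun k => starRingEnd ℂ (d i k) * ⟪f i k, x⟫_ℂ) Finset.univ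
    rw [inner_self_eq_norm_sq_to_K] at h
    push_cast
    refine h.trans (Finset.sum_congr rfl fun k _ => ?_)
    rw [Complex.conj_mul', norm_mul, RCLike.norm_conj, Complex.ofReal_mul, mul_pow]
  -- Bessel's inequality for `g l`, then the orthogonality of the columns of `T`. Summing over `x`
  -- in the basis `b` yields Hilbert–Schmidt norms on both sides.
  have h4 : ∀ x, ∑ l, ∑ m, ‖⟪x, v l m⟫_ℂ‖ ^ 2 ≤
      N * ∑ i, ∑ k, ‖d i k‖ ^ 2 * ‖⟪f i k, x⟫_ℂ‖ ^ 2 := by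
    intro x
    simp only [← h3]
    rw [← sum_norm_sq_sum_smul hT]
    refine Finset.sum_le_sum fun l _ => ?_
    simp only [← h2, norm_inner_symm _ (g l _)]
    exact (hg l).sum_inner_products_le _
  have h5 : ∀ x, ∑' i, ENNReal.ofReal (‖⟪x, b i⟫_ℂ‖ ^ 2) = ENNReal.ofReal (‖x‖ ^ 2) := fun x => by
    simp only [norm_inner_symm x, parseval_ennreal]
  refine (ENNReal.ofReal_le_ofReal_iff (by positivity)).mp ?_
  calc ENNReal.ofReal (∑ l, ∑ m,
        ‖∑ i, ∑ k, (T l i : ℂ) * (⟪h l m, f i k⟫_ℂ * ⟪e i k, g l m⟫_ℂ) * d i k‖ ^ 2)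
      ≤ ENNReal.ofReal (∑ l, ∑ m, ‖v l m‖ ^ 2) := by
        refine ENNReal.ofReal_le_ofReal
          (Finset.sum_le_sum fun l _ => Finset.sum_le_sum fun m _ => ?_)
        rw [h1]
        gcongr
        simpa [(hh l).1 m] using norm_inner_le_norm (𝕜 := ℂ) (h l m) (v l m)
    _ = ∑ l, ∑ m, ∑' i, ENNReal.ofReal (‖⟪b i, v l m⟫_ℂ‖ ^ 2) := by
        simp only [parseval_ennreal]
        rw [ENNReal.ofReal_sum_of_nonneg fun l _ => by positivity]
        refine Finset.sum_congr rfl fun l _ => ?_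
        rw [ENNReal.ofReal_sum_of_nonneg fun m _ => by positivity]
    _ = ∑' i, ∑ l, ∑ m, ENNReal.ofReal (‖⟪b i, v l m⟫_ℂ‖ ^ 2) := by
        rw [Summable.tsum_finsetSum fun l _ => ENNReal.summable]
        refine Finset.sum_congr rfl fun l _ => ?_
        rw [Summable.tsum_finsetSum fun l _ => ENNReal.summable]
    _ ≤ ∑' j, ∑ i, ∑ k, ENNReal.ofReal (N * ‖d i k‖ ^ 2) *
          ENNReal.ofReal (‖⟪f i k, b j⟫_ℂ‖ ^ 2) := by
        refine ENNReal.tsum_le_tsum fun j => ?_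
        have e1 : ∑ l, ∑ m, ENNReal.ofReal (‖⟪b j, v l m⟫_ℂ‖ ^ 2) =
            ENNReal.ofReal (∑ l, ∑ m, ‖⟪b j, v l m⟫_ℂ‖ ^ 2) := by
          rw [ENNReal.ofReal_sum_of_nonneg fun l _ => by positivity]
          refine Finset.sum_congr rfl fun l _ => ?_
          rw [ENNReal.ofReal_sum_of_nonneg fun m _ => by positivity]
        have e2 : ∑ i, ∑ k, ENNReal.ofReal (N * ‖d i k‖ ^ 2) *
            ENNReal.ofReal (‖⟪f i k, b j⟫_ℂ‖ ^ 2) =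
            ENNReal.ofReal (N * ∑ i, ∑ k, ‖d i k‖ ^ 2 * ‖⟪f i k, b j⟫_ℂ‖ ^ 2) := by
          simp only [Finset.mul_sum]
          rw [ENNReal.ofReal_sum_of_nonneg fun l _ => by positivity]
          refine Finset.sum_congr rfl fun l _ => ?_
          rw [ENNReal.ofReal_sum_of_nonneg fun m _ => by positivity]
          refine Finset.sum_congr rfl fun k _ => ?_
          rw [← ENNReal.ofReal_mul (by positivity), mul_assoc]
        rw [e1, e2]
        exact ENNReal.ofReal_le_ofReal (h4 _)
    _ = ∑ i, ∑ k, ENNReal.ofReal (N * ‖d i k‖ ^ 2) := by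
        rw [Summable.tsum_finsetSum fun l _ => ENNReal.summable]
        refine Finset.sum_congr rfl fun l _ => ?_
        rw [Summable.tsum_finsetSum fun l _ => ENNReal.summable]
        refine Finset.sum_congr rfl fun k _ => ?_
        rw [ENNReal.tsum_mul_left, h5, (hf l).1]
        simp
    _ = ENNReal.ofReal (N * ∑ i, ∑ k, ‖d i k‖ ^ 2) := by
        simp only [Finset.mul_sum]
        rw [ENNReal.ofReal_sum_of_nonneg fun l _ => by positivity]
        refine Finset.sum_congr rfl fun l _ => ?_
        rw [ENNReal.ofReal_sum_of_nonneg fun m _ => by positivity]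

/-- The `ℓ¹` endpoint follows from `2ab ≤ a² + b²` and Bessel's inequality for `h l` and `g l`
against unit vectors. The `ℓ²` endpoint is the Hilbert–Schmidt bound combined with Cauchy–Schwarz.
-/
theorem norm_sum_matrixCoeff_le [CompleteSpace H] {T : L → I → ℝ} {N : ℝ} (hN : 0 ≤ N)
    (hT1 : ∀ l i, |T l i| ≤ 1) (hT : ∀ i j, ∑ l, T l i * T l j = if i = j then N else 0)
    {e f : ∀ i, ι i → H} {g h : ∀ l, κ l → H} (he : ∀ i, Orthonormal ℂ (e i))
    (hf : ∀ i, Orthonormal ℂ (f i)) (hg : ∀ l, Orthonormal ℂ (g l))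
    (hh : ∀ l, Orthonormal ℂ (h l))
    {p q : ℝ} (hp : 1 < p) (hp2 : p ≤ 2) (hpq : 1 / p + 1 / q = 1) (hq : 0 < q)
    {c : ∀ l, κ l → ℝ} (hc : ∀ l m, 0 < c l m) {d : ∀ i, ι i → ℝ} (hd : ∀ i k, 0 < d i k) :
    ‖∑ l, ∑ m, ∑ i, ∑ k,
        (c l m : ℂ) * ((T l i : ℂ) * (⟪h l m, f i k⟫_ℂ * ⟪e i k, g l m⟫_ℂ)) * d i k‖ ≤
      N ^ (1 / q) * (∑ i, ∑ k, d i k ^ p) ^ (1 / p) *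
        (∑ l, (∑ m, c l m ^ q) ^ (p / q)) ^ (1 / p) := by
  have key := norm_sum_kernel_le (α := Σ i, ι i)
    (fun l m a => (T l a.1 : ℂ) * (⟪h l m, f a.1 a.2⟫_ℂ * ⟪e a.1 a.2, g l m⟫_ℂ)) hN ?_ ?_
    hp hp2 hpq hq hc (d := fun a => d a.1 a.2) (fun a => hd a.1 a.2)
  · simpa only [Fintype.sum_sigma] using key
  · rintro l ⟨i, k⟩
    have h1 := (hh l).sum_inner_products_le (f i k) (s := Finset.univ)
    have h2 := (hg l).sum_inner_products_le (e i k) (s := Finset.univ)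
    rw [(hf i).1] at h1
    rw [(he i).1] at h2
    have h3 : ∀ m, ‖(T l i : ℂ) * (⟪h l m, f i k⟫_ℂ * ⟪e i k, g l m⟫_ℂ)‖ ≤
        (‖⟪h l m, f i k⟫_ℂ‖ ^ 2 + ‖⟪g l m, e i k⟫_ℂ‖ ^ 2) / 2 := by
      intro m
      rw [norm_mul, Complex.norm_real, Real.norm_eq_abs, norm_mul, norm_inner_symm (e i k)]
      refine (mul_le_of_le_one_left (by positivity) (hT1 l i)).trans ?_
      linarith [two_mul_le_add_sq ‖⟪h l m, f i k⟫_ℂ‖ ‖⟪g l m, e i k⟫_ℂ‖]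
    refine (Finset.sum_le_sum fun m _ => h3 m).trans ?_
    rw [← Finset.sum_div, Finset.sum_add_distrib]
    linarith
  · intro c d
    have h1 := sum_norm_sq_matrixCoeff_le hN hT he hf hg hh fun i k => d ⟨i, k⟩
    simp only [Fintype.sum_sigma]
    set t : ∀ l, κ l → ℂ := fun l m =>
      ∑ i, ∑ k, (T l i : ℂ) * (⟪h l m, f i k⟫_ℂ * ⟪e i k, g l m⟫_ℂ) * d ⟨i, k⟩ with ht
    have h2 : ∑ l, ∑ m, ∑ i, ∑ k,
        c l m * ((T l i : ℂ) * (⟪h l m, f i k⟫_ℂ * ⟪e i k, g l m⟫_ℂ)) * d ⟨i, k⟩ =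
        ∑ a : Σ l, κ l, c a.1 a.2 * t a.1 a.2 := by
      simp only [Fintype.sum_sigma, ht, Finset.mul_sum, mul_assoc]
    rw [h2]
    refine Real.le_sqrt_of_sq_le ?_
    calc ‖∑ a : Σ l, κ l, c a.1 a.2 * t a.1 a.2‖ ^ 2
        ≤ (∑ a : Σ l, κ l, ‖c a.1 a.2‖ * ‖t a.1 a.2‖) ^ 2 := by
          gcongr
          refine (norm_sum_le _ _).trans_eq ?_
          simp only [norm_mul]
      _ ≤ (∑ a : Σ l, κ l, ‖c a.1 a.2‖ ^ 2) * ∑ a : Σ l, κ l, ‖t a.1 a.2‖ ^ 2 :=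
          Finset.sum_mul_sq_le_sq_mul_sq _ _ _
      _ ≤ (∑ l, ∑ m, ‖c l m‖ ^ 2) * (N * ∑ i, ∑ k, ‖d ⟨i, k⟩‖ ^ 2) := by
          simp only [Fintype.sum_sigma]
          gcongr
      _ = _ := by ring

end Kernel

/-! ### Clarkson inequalities for singular values -/

section Clarkson

open Filter Topology

/-- Allows the sums over all the index sets `ι i` to be truncated simultaneously, so that the finite
kernel bound applies before a single passage to the limit. -/
theorem tendsto_pi_finset_apply {I : Type*} (ι : I → Type*) (i : I) :
    Tendsto (fun J : ∀ i, Finset (ι i) => J i) atTop atTop := by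
  classical
  refine tendsto_atTop_atTop_of_monotone (fun J J' h => h i) fun s => ?_
  exact ⟨Function.update (fun _ => ∅) i s, by simp⟩

theorem HasSum.tendsto_pi_finset {I E : Type*} {ι : I → Type*} [AddCommMonoid E]
    [TopologicalSpace E] {i : I} {x : ι i → E} {a : E} (h : HasSum x a) :
    Tendsto (fun J : ∀ i, Finset (ι i) => ∑ k ∈ J i, x k) atTop (𝓝 a) :=
  have h' : Tendsto (fun s : Finset (ι i) => ∑ k ∈ s, x k) atTop (𝓝 a) := by simpa [HasSum] using h
  h'.comp (tendsto_pi_finset_apply ι i)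

instance neBot_atTop_pi_finset {I : Type*} (ι : I → Type*) :
    (atTop : Filter (∀ i, Finset (ι i))).NeBot := by
  classical
  exact atTop_neBot

variable {H : Type*} [NormedAddCommGroup H] [InnerProductSpace ℂ H]

theorem apply_eq_smul_of_hasSum {X : H →L[ℂ] H} {κ : Type*} {s : κ → ℝ} {e f : κ → H}
    (he : Orthonormal ℂ e) (h : ∀ x, HasSum (fun k => ((s k : ℂ) * ⟪e k, x⟫_ℂ) • f k) (X x))
    (k : κ) : X (e k) = (s k : ℂ) • f k := by
  classical
  refine (h (e k)).unique ?_
  have h1 := hasSum_single (f := fun j => ((s j : ℂ) * ⟪e j, e k⟫_ℂ) • f j) k fun j hj => by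
    rw [he.2 hj, mul_zero, zero_smul]
  simpa [inner_self_eq_norm_sq_to_K, he.1 k] using h1

variable {L I : Type*} [Fintype L] [Fintype I] [DecidableEq I] {ι : I → Type*} {κ : L → Type*}

theorem norm_sum_finset_matrixCoeff_le [CompleteSpace H] {T : L → I → ℝ} {N : ℝ} (hN : 0 ≤ N)
    (hT1 : ∀ l i, |T l i| ≤ 1) (hT : ∀ i j, ∑ l, T l i * T l j = if i = j then N else 0)
    {e f : ∀ i, ι i → H} {g h : ∀ l, κ l → H} (he : ∀ i, Orthonormal ℂ (e i))
    (hf : ∀ i, Orthonormal ℂ (f i)) (hg : ∀ l, Orthonormal ℂ (g l))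
    (hh : ∀ l, Orthonormal ℂ (h l))
    {p q : ℝ} (hp : 1 < p) (hp2 : p ≤ 2) (hpq : 1 / p + 1 / q = 1) (hq : 0 < q)
    (M : ∀ l, Finset (κ l)) (J : ∀ i, Finset (ι i))
    {c : ∀ l, κ l → ℝ} (hc : ∀ l, ∀ m ∈ M l, 0 < c l m) {d : ∀ i, ι i → ℝ}
    (hd : ∀ i k, 0 < d i k) :
    ‖∑ l, ∑ m ∈ M l, ∑ i, ∑ k ∈ J i,
        (c l m : ℂ) * ((T l i : ℂ) * (⟪h l m, f i k⟫_ℂ * ⟪e i k, g l m⟫_ℂ)) * d i k‖ ≤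
      N ^ (1 / q) * (∑ i, ∑ k ∈ J i, d i k ^ p) ^ (1 / p) *
        (∑ l, (∑ m ∈ M l, c l m ^ q) ^ (p / q)) ^ (1 / p) := by
  have key := norm_sum_matrixCoeff_le (ι := fun i => J i) (κ := fun l => M l) hN hT1 hT
    (e := fun i k => e i k) (f := fun i k => f i k) (g := fun l m => g l m)
    (h := fun l m => h l m)
    (fun i => (he i).comp _ Subtype.val_injective) (fun i => (hf i).comp _ Subtype.val_injective)
    (fun l => (hg l).comp _ Subtype.val_injective) (fun l => (hh l).comp _ Subtype.val_injective)
    hp hp2 hpq hq (c := fun l m => c l m) (fun l m => hc l m m.2) (d := fun i k => d i k)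
    (fun i k => hd i k)
  have e1 : ∀ l (m : κ l) i, ∑ k : J i,
      (c l m : ℂ) * ((T l i : ℂ) * (⟪h l m, f i k⟫_ℂ * ⟪e i k, g l m⟫_ℂ)) * d i k =
      ∑ k ∈ J i,
        (c l m : ℂ) * ((T l i : ℂ) * (⟪h l m, f i k⟫_ℂ * ⟪e i k, g l m⟫_ℂ)) * d i k :=
    fun l m i => Finset.sum_coe_sort (J i)
      fun k => (c l m : ℂ) * ((T l i : ℂ) * (⟪h l m, f i k⟫_ℂ * ⟪e i k, g l m⟫_ℂ)) * d i k
  have e2 : ∀ l, ∑ m : M l, ∑ i, ∑ k ∈ J i,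
      (c l m : ℂ) * ((T l i : ℂ) * (⟪h l m, f i k⟫_ℂ * ⟪e i k, g l m⟫_ℂ)) * d i k =
      ∑ m ∈ M l, ∑ i, ∑ k ∈ J i,
        (c l m : ℂ) * ((T l i : ℂ) * (⟪h l m, f i k⟫_ℂ * ⟪e i k, g l m⟫_ℂ)) * d i k :=
    fun l => Finset.sum_coe_sort (M l) fun m => ∑ i, ∑ k ∈ J i,
      (c l m : ℂ) * ((T l i : ℂ) * (⟪h l m, f i k⟫_ℂ * ⟪e i k, g l m⟫_ℂ)) * d i k
  have e3 : ∀ i, ∑ k : J i, d i k ^ p = ∑ k ∈ J i, d i k ^ p :=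
    fun i => Finset.sum_coe_sort (J i) fun k => d i k ^ p
  have e4 : ∀ l, ∑ m : M l, c l m ^ q = ∑ m ∈ M l, c l m ^ q :=
    fun l => Finset.sum_coe_sort (M l) fun m => c l m ^ q
  simpa only [e1, e2, e3, e4] using key

/-- The factor `W ^ (1 / p)` is absorbed on the left, leaving `W ^ (1 / q)`; this needs `W` finite.
-/
theorem le_mul_rpow_of_le_rpow_mul {p q N V W : ℝ} (hq : 0 < q)
    (hpq : 1 / p + 1 / q = 1) (hN : 0 ≤ N) (hV : 0 ≤ V) (hW : 0 ≤ W)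
    (h : W ≤ N ^ (1 / q) * V ^ (1 / p) * W ^ (1 / p)) : W ≤ N * V ^ (q / p) := by
  rcases hW.eq_or_lt with rfl | hW
  · positivity
  have h1 : W ^ (1 / q) ≤ N ^ (1 / q) * V ^ (1 / p) := by
    refine le_of_mul_le_mul_right ?_ (Real.rpow_pos_of_pos hW (1 / p))
    rwa [← Real.rpow_add hW, add_comm, hpq, Real.rpow_one]
  have h2 := Real.rpow_le_rpow (by positivity) h1 hq.le
  rwa [Real.mul_rpow (by positivity) (by positivity), ← Real.rpow_mul hW.le, ← Real.rpow_mul hN,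
    ← Real.rpow_mul hV, one_div_mul_cancel hq.ne', Real.rpow_one, Real.rpow_one,
    one_div_mul_eq_div] at h2

/-- Duality: the left side is the pairing of `B` with its norming functional. The sets `M l` are
finite so that this quantity is finite and can be divided out; no summability of the `t l m ^ p` is
presupposed. -/
theorem sum_schatten_rpow_le [CompleteSpace H] {T : L → I → ℝ} {N : ℝ} (hN : 0 ≤ N)
    (hT1 : ∀ l i, |T l i| ≤ 1) (hT : ∀ i j, ∑ l, T l i * T l j = if i = j then N else 0)
    {A : I → H →L[ℂ] H}
    {e f : ∀ i, ι i → H} {g h : ∀ l, κ l → H} (he : ∀ i, Orthonormal ℂ (e i))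
    (hf : ∀ i, Orthonormal ℂ (f i)) (hg : ∀ l, Orthonormal ℂ (g l))
    (hh : ∀ l, Orthonormal ℂ (h l)) {s : ∀ i, ι i → ℝ} {t : ∀ l, κ l → ℝ}
    (hs : ∀ i k, 0 < s i k) (ht : ∀ l m, 0 < t l m)
    (hA : ∀ i x, HasSum (fun k => ((s i k : ℂ) * ⟪e i k, x⟫_ℂ) • f i k) (A i x))
    (hB : ∀ l m, (∑ i, (T l i : ℂ) • A i) (g l m) = (t l m : ℂ) • h l m)
    {p q : ℝ} (hp : 1 < p) (hp2 : p ≤ 2) (hpq : 1 / p + 1 / q = 1) (hq : 0 < q)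
    (hsum : ∀ i, Summable fun k => s i k ^ p) (M : ∀ l, Finset (κ l)) :
    ∑ l, (∑ m ∈ M l, t l m ^ p) ^ (q / p) ≤ N * (∑ i, ∑' k, s i k ^ p) ^ (q / p) := by
  have hp0 : 0 < p := by linarith
  have hpq' : p + q = p * q := by field_simp at hpq; linarith
  set τ : L → ℝ := fun l => ∑ m ∈ M l, t l m ^ p with hτ
  have hτ0 : ∀ l, 0 ≤ τ l := fun l => Finset.sum_nonneg fun m _ => Real.rpow_nonneg (ht l m).le _
  have hτpos : ∀ l, ∀ m ∈ M l, 0 < τ l := fun l m hm =>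
    Finset.sum_pos (fun m _ => Real.rpow_pos_of_pos (ht l m) _) ⟨m, hm⟩
  -- The norming functional: the power of `τ l` is chosen so that both `∑ c * t` and `(∑ c ^ q) ^ (p
  -- / q)` equal `τ l ^ (q / p)`.
  set c : ∀ l, κ l → ℝ := fun l m => τ l ^ ((q - p) / p) * t l m ^ (p - 1) with hcdef
  have hc : ∀ l, ∀ m ∈ M l, 0 < c l m := fun l m hm =>
    mul_pos (Real.rpow_pos_of_pos (hτpos l m hm) _) (Real.rpow_pos_of_pos (ht l m) _)
  have hct : ∀ l, ∑ m ∈ M l, c l m * t l m = τ l ^ (q / p) := by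
    intro l
    have h1 : ∀ m ∈ M l, c l m * t l m = τ l ^ ((q - p) / p) * t l m ^ p := by
      intro m hm
      rw [hcdef, mul_assoc, ← Real.rpow_add_one (ht l m).ne', sub_add_cancel]
    rw [Finset.sum_congr rfl h1, ← Finset.mul_sum]
    rcases (M l).eq_empty_or_nonempty with h0 | ⟨m, hm⟩
    · have : τ l = 0 := by simp only [hτ, h0, Finset.sum_empty]
      rw [h0, Finset.sum_empty, mul_zero, this, Real.zero_rpow (by positivity)]
    · rw [← Real.rpow_add_one (hτpos l m hm).ne']
      congr 1
      field_simp
      ring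
  have hcq : ∀ l, (∑ m ∈ M l, c l m ^ q) ^ (p / q) = τ l ^ (q / p) := by
    intro l
    have h1 : ∀ m ∈ M l, c l m ^ q = τ l ^ ((q - p) / p * q) * t l m ^ p := by
      intro m hm
      rw [hcdef, Real.mul_rpow (Real.rpow_nonneg (hτ0 l) _) (Real.rpow_nonneg (ht l m).le _),
        ← Real.rpow_mul (hτ0 l), ← Real.rpow_mul (ht l m).le]
      congr 2
      linarith
    rw [Finset.sum_congr rfl h1, ← Finset.mul_sum]
    rcases (M l).eq_empty_or_nonempty with h0 | ⟨m, hm⟩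
    · have : τ l = 0 := by simp only [hτ, h0, Finset.sum_empty]
      rw [h0, Finset.sum_empty, mul_zero, this, Real.zero_rpow (by positivity),
        Real.zero_rpow (by positivity)]
    · rw [← Real.rpow_add_one (hτpos l m hm).ne', ← Real.rpow_mul (hτ0 l)]
      congr 1
      field_simp
      linear_combination (p - q) * hpq'
  set W := ∑ l, τ l ^ (q / p) with hW
  set V := ∑ i, ∑' k, s i k ^ p with hV
  have hsp : ∀ i k, 0 ≤ s i k ^ p := fun i k => Real.rpow_nonneg (hs i k).le _
  have hW0 : 0 ≤ W := Finset.sum_nonneg fun l _ => Real.rpow_nonneg (hτ0 l) _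
  have hV0 : 0 ≤ V := Finset.sum_nonneg fun i _ => tsum_nonneg (hsp i)
  refine le_mul_rpow_of_le_rpow_mul hq hpq hN hV0 hW0 ?_
  -- As `J` grows, the inner sums rebuild `⟪h l m, A i (g l m)⟫`, and summing these against `T l i`
  -- gives `t l m`.
  have hlim : Tendsto (fun J : ∀ i, Finset (ι i) => ∑ l, ∑ m ∈ M l, ∑ i, ∑ k ∈ J i,
      (c l m : ℂ) * ((T l i : ℂ) * (⟪h l m, f i k⟫_ℂ * ⟪e i k, g l m⟫_ℂ)) * s i k) atTop
      (𝓝 (W : ℂ)) := by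
    have hWc : (W : ℂ) = ∑ l, ∑ m ∈ M l, ∑ i, (c l m : ℂ) * (T l i : ℂ) *
        ⟪h l m, A i (g l m)⟫_ℂ := by
      rw [hW, Complex.ofReal_sum]
      refine Finset.sum_congr rfl fun l _ => ?_
      rw [← hct, Complex.ofReal_sum]
      refine Finset.sum_congr rfl fun m _ => ?_
      have h1 : ⟪h l m, (∑ i, (T l i : ℂ) • A i) (g l m)⟫_ℂ = t l m := by
        rw [hB, inner_smul_right, inner_self_eq_norm_sq_to_K, (hh l).1]
        simp
      rw [Complex.ofReal_mul, ← h1, sum_apply, inner_sum, Finset.mul_sum]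
      refine Finset.sum_congr rfl fun i _ => ?_
      rw [smul_apply, inner_smul_right, mul_assoc]
    rw [hWc]
    refine tendsto_finsetSum _ fun l _ => tendsto_finsetSum _ fun m _ =>
      tendsto_finsetSum _ fun i _ => HasSum.tendsto_pi_finset ?_
    have h1 := ((hA i (g l m)).mapL (innerSL ℂ (h l m))).mul_left ((c l m : ℂ) * (T l i : ℂ))
    simp only [innerSL_apply_apply, inner_smul_right] at h1
    refine (congrArg (HasSum · _) (funext fun k => ?_)).mp h1
    ring
  have hle : ∀ J : ∀ i, Finset (ι i), ‖∑ l, ∑ m ∈ M l, ∑ i, ∑ k ∈ J i,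
      (c l m : ℂ) * ((T l i : ℂ) * (⟪h l m, f i k⟫_ℂ * ⟪e i k, g l m⟫_ℂ)) * s i k‖ ≤
      N ^ (1 / q) * V ^ (1 / p) * W ^ (1 / p) := by
    intro J
    refine (norm_sum_finset_matrixCoeff_le hN hT1 hT he hf hg hh hp hp2 hpq hq M J hc hs).trans ?_
    simp only [hcq]
    rw [← hW]
    have h1 : ∑ i, ∑ k ∈ J i, s i k ^ p ≤ V :=
      Finset.sum_le_sum fun i _ => (hsum i).sum_le_tsum _ fun k _ => hsp i k
    have h2 : 0 ≤ ∑ i, ∑ k ∈ J i, s i k ^ p :=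
      Finset.sum_nonneg fun i _ => Finset.sum_nonneg fun k _ => hsp i k
    gcongr
  have := le_of_tendsto' hlim.norm hle
  rwa [Complex.norm_real, Real.norm_of_nonneg hW0] at this

/-- The dual argument: `N * V` is the pairing of `TᵀT A = N A` with the norming functional `s ^ (p -
1)` of `A`. Moving one `T` across makes it a pairing with `B`, to which the kernel bound applies
with exponents `q ≤ 2` and `p` in exchanged roles. -/
theorem le_sum_schatten_rpow [CompleteSpace H] {T : L → I → ℝ} {N : ℝ} (hN : 0 ≤ N)
    (hT1 : ∀ l i, |T l i| ≤ 1) (hT : ∀ i j, ∑ l, T l i * T l j = if i = j then N else 0)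
    {A : I → H →L[ℂ] H}
    {e f : ∀ i, ι i → H} {g h : ∀ l, κ l → H} (he : ∀ i, Orthonormal ℂ (e i))
    (hf : ∀ i, Orthonormal ℂ (f i)) (hg : ∀ l, Orthonormal ℂ (g l))
    (hh : ∀ l, Orthonormal ℂ (h l)) {s : ∀ i, ι i → ℝ} {t : ∀ l, κ l → ℝ}
    (hs : ∀ i k, 0 < s i k) (ht : ∀ l m, 0 < t l m)
    (hA : ∀ i k, A i (e i k) = (s i k : ℂ) • f i k)
    (hB : ∀ l x, HasSum (fun m => ((t l m : ℂ) * ⟪g l m, x⟫_ℂ) • h l m)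
      ((∑ i, (T l i : ℂ) • A i) x))
    {p q : ℝ} (hp2 : 2 ≤ p) (hpq : 1 / p + 1 / q = 1) (hq : 0 < q)
    (hsum : ∀ l, Summable fun m => t l m ^ p) (J : ∀ i, Finset (ι i)) :
    N * (∑ i, ∑ k ∈ J i, s i k ^ p) ^ (q / p) ≤ ∑ l, (∑' m, t l m ^ p) ^ (q / p) := by
  have hp0 : 0 < p := by linarith
  have hpq' : p + q = p * q := by field_simp at hpq; linarith
  have hq2 : q ≤ 2 := by nlinarith
  have hq1 : 1 < q := by nlinarith
  set V := ∑ i, ∑ k ∈ J i, s i k ^ p with hV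
  set Y := ∑ l, (∑' m, t l m ^ p) ^ (q / p) with hY
  have hsp : ∀ i k, 0 ≤ s i k ^ p := fun i k => Real.rpow_nonneg (hs i k).le _
  have htp : ∀ l m, 0 ≤ t l m ^ p := fun l m => Real.rpow_nonneg (ht l m).le _
  have hV0 : 0 ≤ V := Finset.sum_nonneg fun i _ => Finset.sum_nonneg fun k _ => hsp i k
  have hY0 : 0 ≤ Y := Finset.sum_nonneg fun l _ => Real.rpow_nonneg (tsum_nonneg (htp l)) _
  set d : ∀ i, ι i → ℝ := fun i k => s i k ^ (p - 1) with hd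
  have hdpos : ∀ i k, 0 < d i k := fun i k => Real.rpow_pos_of_pos (hs i k) _
  have hds : ∀ i k, d i k * s i k = s i k ^ p := fun i k => by
    rw [hd, ← Real.rpow_add_one (hs i k).ne', sub_add_cancel]
  have hdq : ∀ i k, d i k ^ q = s i k ^ p := fun i k => by
    rw [hd, ← Real.rpow_mul (hs i k).le]
    congr 1
    linarith
  have hTA : ∀ i, ∑ l, (T l i : ℂ) • ∑ j, (T l j : ℂ) • A j = (N : ℂ) • A i := by
    intro i
    have h1 : ∀ j, ∑ l, (T l i : ℂ) * (T l j : ℂ) = if i = j then (N : ℂ) else 0 := by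
      intro j
      have := congrArg (fun x : ℝ => (x : ℂ)) (hT i j)
      simpa [apply_ite] using this
    simp only [Finset.smul_sum, smul_smul]
    rw [Finset.sum_comm]
    simp only [← Finset.sum_smul, h1, ite_smul, zero_smul, Finset.sum_ite_eq, Finset.mem_univ,
      if_true]
  have hlim : Tendsto (fun M : ∀ l, Finset (κ l) => ∑ l, ∑ m ∈ M l, ∑ i, ∑ k ∈ J i,
      (t l m : ℂ) * ((T l i : ℂ) * (⟪h l m, f i k⟫_ℂ * ⟪e i k, g l m⟫_ℂ)) * d i k) atTop
      (𝓝 ((N * V : ℝ) : ℂ)) := by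
    have hc : ((N * V : ℝ) : ℂ) = ∑ l, ∑ i, ∑ k ∈ J i, (T l i : ℂ) * d i k *
        ⟪(∑ j, (T l j : ℂ) • A j) (e i k), f i k⟫_ℂ := by
      rw [Finset.sum_comm, hV, Complex.ofReal_mul, Complex.ofReal_sum, Finset.mul_sum]
      refine Finset.sum_congr rfl fun i _ => ?_
      rw [Finset.sum_comm, Complex.ofReal_sum, Finset.mul_sum]
      refine Finset.sum_congr rfl fun k _ => ?_
      have h1 : ⟪(∑ l, (T l i : ℂ) • ∑ j, (T l j : ℂ) • A j) (e i k), f i k⟫_ℂ = N * s i k := by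
        rw [hTA, smul_apply, hA, inner_smul_left, inner_smul_left, inner_self_eq_norm_sq_to_K,
          (hf i).1]
        simp
      rw [← hds, Complex.ofReal_mul, mul_left_comm, ← h1, sum_apply, sum_inner, Finset.mul_sum]
      refine Finset.sum_congr rfl fun l _ => ?_
      rw [smul_apply, inner_smul_left, Complex.conj_ofReal]
      ring
    rw [hc]
    refine tendsto_finsetSum _ fun l _ => HasSum.tendsto_pi_finset ?_
    refine hasSum_sum fun i _ => hasSum_sum fun k _ => ?_
    have h1 := ((hB l (e i k)).mapL (innerSL ℂ (f i k))).star.mul_left ((T l i : ℂ) * d i k)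
    simp only [innerSL_apply_apply, RCLike.star_def, inner_conj_symm] at h1
    refine (congrArg (HasSum · _) (funext fun m => ?_)).mp h1
    rw [inner_smul_left, map_mul, inner_conj_symm, Complex.conj_ofReal]
    ring
  have hle : ∀ M : ∀ l, Finset (κ l), ‖∑ l, ∑ m ∈ M l, ∑ i, ∑ k ∈ J i,
      (t l m : ℂ) * ((T l i : ℂ) * (⟪h l m, f i k⟫_ℂ * ⟪e i k, g l m⟫_ℂ)) * d i k‖ ≤
      N ^ (1 / p) * V ^ (1 / q) * Y ^ (1 / q) := by
    intro M
    refine (norm_sum_finset_matrixCoeff_le hN hT1 hT he hf hg hh hq1 hq2 (by linarith) hp0 M J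
      (fun l m _ => ht l m) hdpos).trans ?_
    simp only [hdq]
    rw [← hV]
    have h1 : ∀ l, ∑ m ∈ M l, t l m ^ p ≤ ∑' m, t l m ^ p := fun l =>
      (hsum l).sum_le_tsum _ fun m _ => htp l m
    have h0 : ∀ l, 0 ≤ ∑ m ∈ M l, t l m ^ p := fun l => Finset.sum_nonneg fun m _ => htp l m
    have h2 : ∑ l, (∑ m ∈ M l, t l m ^ p) ^ (q / p) ≤ Y :=
      Finset.sum_le_sum fun l _ => Real.rpow_le_rpow (h0 l) (h1 l) (by positivity)
    have h3 : 0 ≤ ∑ l, (∑ m ∈ M l, t l m ^ p) ^ (q / p) :=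
      Finset.sum_nonneg fun l _ => Real.rpow_nonneg (h0 l) _
    gcongr
  have key := le_of_tendsto' hlim.norm hle
  rw [Complex.norm_real, Real.norm_of_nonneg (mul_nonneg hN hV0)] at key
  -- The remaining step divides by powers of `N` and `V`, so their vanishing is treated apart.
  rcases hN.eq_or_lt with rfl | hN
  · simpa using hY0
  rcases hV0.eq_or_lt with hV0 | hV0
  · rw [← hV0, Real.zero_rpow (by positivity), mul_zero]
    exact hY0
  have h1 : N ^ (1 / q) * V ^ (1 / p) ≤ Y ^ (1 / q) := by
    refine le_of_mul_le_mul_left ?_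
      (mul_pos (Real.rpow_pos_of_pos hN (1 / p)) (Real.rpow_pos_of_pos hV0 (1 / q)))
    refine le_trans (le_of_eq ?_) key
    rw [mul_mul_mul_comm, ← Real.rpow_add hN, ← Real.rpow_add hV0, add_comm (1 / q), hpq,
      Real.rpow_one, Real.rpow_one]
  have h2 := Real.rpow_le_rpow (by positivity) h1 hq.le
  rwa [Real.mul_rpow (by positivity) (by positivity), ← Real.rpow_mul hN.le, ← Real.rpow_mul hV0.le,
    ← Real.rpow_mul hY0, one_div_mul_cancel hq.ne', Real.rpow_one, Real.rpow_one,
    one_div_mul_eq_div] at h2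

end Clarkson

/-! ### Passage to Schatten norms with values in `[0, ∞]` -/

section Schatten

open Filter Topology

theorem schattenNorm_rpow {H : Type*} [NormedAddCommGroup H] [InnerProductSpace ℂ H]
    [CompleteSpace H] (p q : ℝ) (X : H →L[ℂ] H) :
    schattenNorm p X ^ q = posTrace (CFC.abs X ^ p) ^ (q / p) := by
  rw [schattenNorm, ← ENNReal.rpow_mul, one_div_mul_eq_div]

theorem schattenNorm_rpow_self {H : Type*} [NormedAddCommGroup H] [InnerProductSpace ℂ H]
    [CompleteSpace H] {p : ℝ} (hp : 0 < p) (X : H →L[ℂ] H) :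
    schattenNorm p X ^ p = posTrace (CFC.abs X ^ p) := by
  rw [schattenNorm_rpow, div_self hp.ne', ENNReal.rpow_one]

theorem summable_of_tsum_ofReal_lt_top {α : Type*} {x : α → ℝ} (hx : ∀ a, 0 ≤ x a)
    (h : ∑' a, ENNReal.ofReal (x a) < ∞) : Summable x :=
  (ENNReal.summable_toReal h.ne).congr fun a => ENNReal.toReal_ofReal (hx a)

theorem isCompactOperator_sum_smul {H : Type*} [NormedAddCommGroup H] [InnerProductSpace ℂ H]
    {I : Type*} [Fintype I] {A : I → H →L[ℂ] H} (hA : ∀ i, IsCompactOperator (A i))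
    (T : I → ℂ) : IsCompactOperator (∑ i, T i • A i : H →L[ℂ] H) :=
  Submodule.sum_mem (compactOperator (RingHom.id ℂ) H H) fun i _ =>
    Submodule.smul_mem _ _ (hA i)

variable {H : Type*} [NormedAddCommGroup H] [InnerProductSpace ℂ H] [CompleteSpace H]
  {L I : Type*} [Fintype L] [Fintype I] [DecidableEq I]

/-- Clarkson–McCarthy inequality for a multiple of an isometry with entries at most one in
absolute value, in the range `1 < p ≤ 2`. -/
theorem sum_schattenNorm_rpow_le {T : L → I → ℝ} {N : ℝ} (hN : 0 ≤ N)
    (hT1 : ∀ l i, |T l i| ≤ 1) (hT : ∀ i j, ∑ l, T l i * T l j = if i = j then N else 0)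
    {p q : ℝ} (hp : 1 < p) (hp2 : p ≤ 2) (hpq : 1 / p + 1 / q = 1) (hq : 0 < q)
    {A : I → H →L[ℂ] H} (hA : ∀ i, A i ∈ schattenClass H p) :
    ∑ l, schattenNorm p (∑ i, (T l i : ℂ) • A i) ^ q ≤
      ENNReal.ofReal N * (∑ i, schattenNorm p (A i) ^ p) ^ (q / p) := by
  have hp0 : 0 < p := by linarith
  choose ι s e f hs he hf hAe hsp using fun i => (hA i).1.exists_schmidt
  choose κ t g h ht hg hh hBg htp using fun l =>
    (isCompactOperator_sum_smul (fun i => (hA i).1) fun i => (T l i : ℂ)).exists_schmidt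
  have hfin : ∀ i, ∑' k, ENNReal.ofReal (s i k ^ p) < ∞ := fun i => by
    rw [← hsp i p hp0, ← schattenNorm_rpow_self hp0]
    exact ENNReal.rpow_lt_top_of_nonneg hp0.le (hA i).2.ne
  have hsp0 : ∀ i k, 0 ≤ s i k ^ p := fun i k => Real.rpow_nonneg (hs i k).le _
  have htp0 : ∀ l m, 0 ≤ t l m ^ p := fun l m => Real.rpow_nonneg (ht l m).le _
  have hsum : ∀ i, Summable fun k => s i k ^ p := fun i =>
    summable_of_tsum_ofReal_lt_top (hsp0 i) (hfin i)
  have hs0 : ∀ i, 0 ≤ ∑' k, s i k ^ p := fun i => tsum_nonneg (hsp0 i)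
  have hqp : 0 ≤ q / p := by positivity
  have hR : ENNReal.ofReal N * (∑ i, schattenNorm p (A i) ^ p) ^ (q / p) =
      ENNReal.ofReal (N * (∑ i, ∑' k, s i k ^ p) ^ (q / p)) := by
    simp only [schattenNorm_rpow_self hp0, hsp _ p hp0]
    rw [ENNReal.ofReal_mul hN, ← ENNReal.ofReal_rpow_of_nonneg
      (Finset.sum_nonneg fun i _ => hs0 i) hqp, ENNReal.ofReal_sum_of_nonneg fun i _ => hs0 i]
    simp only [ENNReal.ofReal_tsum_of_nonneg (hsp0 _) (hsum _)]
  have hlim : Tendsto (fun M : ∀ l, Finset (κ l) =>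
      ∑ l, (∑ m ∈ M l, ENNReal.ofReal (t l m ^ p)) ^ (q / p)) atTop
      (𝓝 (∑ l, (∑' m, ENNReal.ofReal (t l m ^ p)) ^ (q / p))) :=
    tendsto_finsetSum _ fun l _ => (ENNReal.continuous_rpow_const.tendsto _).comp
      ENNReal.summable.hasSum.tendsto_pi_finset
  simp only [schattenNorm_rpow p q, htp _ p hp0]
  refine le_of_tendsto' hlim fun M => ?_
  rw [hR]
  refine le_trans (le_of_eq ?_) (ENNReal.ofReal_le_ofReal
    (sum_schatten_rpow_le hN hT1 hT he hf hg hh hs ht hAe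
      (fun l m => apply_eq_smul_of_hasSum (hg l) (hBg l) m) hp hp2 hpq hq hsum M))
  have h0 : ∀ l, 0 ≤ ∑ m ∈ M l, t l m ^ p := fun l => Finset.sum_nonneg fun m _ => htp0 l m
  rw [ENNReal.ofReal_sum_of_nonneg fun l _ => Real.rpow_nonneg (h0 l) _]
  refine Finset.sum_congr rfl fun l _ => ?_
  rw [← ENNReal.ofReal_rpow_of_nonneg (h0 l) hqp, ENNReal.ofReal_sum_of_nonneg fun m _ => htp0 l m]

/-- Clarkson–McCarthy inequality for a multiple of an isometry with entries at most one in
absolute value, in the range `2 ≤ p`. -/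
theorem le_sum_schattenNorm_rpow {T : L → I → ℝ} {N : ℝ} (hN : 0 ≤ N)
    (hT1 : ∀ l i, |T l i| ≤ 1) (hT : ∀ i j, ∑ l, T l i * T l j = if i = j then N else 0)
    {p q : ℝ} (hp2 : 2 ≤ p) (hpq : 1 / p + 1 / q = 1) (hq : 0 < q)
    {A : I → H →L[ℂ] H} (hA : ∀ i, IsCompactOperator (A i)) :
    ENNReal.ofReal N * (∑ i, schattenNorm p (A i) ^ p) ^ (q / p) ≤
      ∑ l, schattenNorm p (∑ i, (T l i : ℂ) • A i) ^ q := by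
  have hp0 : 0 < p := by linarith
  have hqp : 0 < q / p := by positivity
  choose ι s e f hs he hf hAe hsp using fun i => (hA i).exists_schmidt
  choose κ t g h ht hg hh hBg htp using fun l =>
    (isCompactOperator_sum_smul hA fun i => (T l i : ℂ)).exists_schmidt
  simp only [schattenNorm_rpow_self hp0, schattenNorm_rpow p q, htp _ p hp0, hsp _ p hp0]
  -- If some `B_l` has infinite Schatten norm, the right side is `∞`. Hence compactness of the `A i`
  -- is enough here.
  by_cases hfin : ∀ l, ∑' m, ENNReal.ofReal (t l m ^ p) < ∞
  swap
  · push Not at hfin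
    obtain ⟨l, hl⟩ := hfin
    refine le_trans (le_of_le_of_eq le_top ?_) (Finset.single_le_sum
      (f := fun l => (∑' m, ENNReal.ofReal (t l m ^ p)) ^ (q / p)) (fun _ _ => zero_le)
      (Finset.mem_univ l))
    rw [top_le_iff.mp hl, ENNReal.top_rpow_of_pos hqp]
  have hsp0 : ∀ i k, 0 ≤ s i k ^ p := fun i k => Real.rpow_nonneg (hs i k).le _
  have htp0 : ∀ l m, 0 ≤ t l m ^ p := fun l m => Real.rpow_nonneg (ht l m).le _
  have hsum : ∀ l, Summable fun m => t l m ^ p := fun l =>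
    summable_of_tsum_ofReal_lt_top (htp0 l) (hfin l)
  have ht0 : ∀ l, 0 ≤ ∑' m, t l m ^ p := fun l => tsum_nonneg (htp0 l)
  have hR : ∑ l, (∑' m, ENNReal.ofReal (t l m ^ p)) ^ (q / p) =
      ENNReal.ofReal (∑ l, (∑' m, t l m ^ p) ^ (q / p)) := by
    rw [ENNReal.ofReal_sum_of_nonneg fun l _ => Real.rpow_nonneg (ht0 l) _]
    refine Finset.sum_congr rfl fun l _ => ?_
    rw [← ENNReal.ofReal_rpow_of_nonneg (ht0 l) hqp.le,
      ENNReal.ofReal_tsum_of_nonneg (htp0 l) (hsum l)]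
  have hlim : Tendsto (fun J : ∀ i, Finset (ι i) => ENNReal.ofReal N *
      (∑ i, ∑ k ∈ J i, ENNReal.ofReal (s i k ^ p)) ^ (q / p)) atTop
      (𝓝 (ENNReal.ofReal N * (∑ i, ∑' k, ENNReal.ofReal (s i k ^ p)) ^ (q / p))) :=
    ENNReal.Tendsto.const_mul ((ENNReal.continuous_rpow_const.tendsto _).comp
      (tendsto_finsetSum _ fun i _ => ENNReal.summable.hasSum.tendsto_pi_finset))
      (Or.inr ENNReal.ofReal_ne_top)
  refine le_of_tendsto' hlim fun J => ?_
  rw [hR]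
  refine le_trans (le_of_eq ?_) (ENNReal.ofReal_le_ofReal
    (le_sum_schatten_rpow hN hT1 hT he hf hg hh hs ht
      (fun i k => apply_eq_smul_of_hasSum (he i) (hAe i) k) hBg hp2 hpq hq hsum J))
  have h0 : ∀ i, 0 ≤ ∑ k ∈ J i, s i k ^ p := fun i => Finset.sum_nonneg fun k _ => hsp0 i k
  rw [ENNReal.ofReal_mul hN, ← ENNReal.ofReal_rpow_of_nonneg
    (Finset.sum_nonneg fun i _ => h0 i) hqp.le, ENNReal.ofReal_sum_of_nonneg fun i _ => h0 i]
  simp only [ENNReal.ofReal_sum_of_nonneg fun k _ => hsp0 _ k]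

end Schatten

/-! ### The matrix of sums and differences -/

section SumDifference

/-- The matrix of the map sending `A` to the sum of its entries and their differences
`A i - A j`, `i < j`. -/
def sumDiffMatrix (n : ℕ) : Option {ij : Fin n × Fin n // ij.1 < ij.2} → Fin n → ℝ
  | none, _ => 1
  | some ij, i => (if i = ij.1.1 then 1 else 0) - if i = ij.1.2 then 1 else 0

theorem abs_sumDiffMatrix_le (n : ℕ) (l : Option {ij : Fin n × Fin n // ij.1 < ij.2}) (i : Fin n) :
    |sumDiffMatrix n l i| ≤ 1 := by
  rcases l with _ | l
  · simp [sumDiffMatrix]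
  · simp only [sumDiffMatrix]
    split_ifs <;> norm_num

/-- The summand `φ` is symmetric in the pair and vanishes on the diagonal, so the sum over `a < b`
is half of the full double sum `2 n δ_ij - 2`. The row of ones contributes the missing 1. -/
theorem sum_sumDiffMatrix_mul (n : ℕ) (i j : Fin n) :
    ∑ l, sumDiffMatrix n l i * sumDiffMatrix n l j = if i = j then (n : ℝ) else 0 := by
  let δ : Fin n → Fin n → ℝ := fun i a => if i = a then 1 else 0
  let φ : Fin n × Fin n → ℝ := fun x => (δ i x.1 - δ i x.2) * (δ j x.1 - δ j x.2)
  have h1 : ∑ l : {ij : Fin n × Fin n // ij.1 < ij.2}, φ l =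
      ∑ a, ∑ b, if a < b then φ (a, b) else 0 := by
    rw [← Finset.sum_subtype (Finset.univ.filter fun x : Fin n × Fin n => x.1 < x.2) (by simp) φ,
      Finset.sum_filter, Fintype.sum_prod_type]
  have h2 : ∑ a, ∑ b, φ (a, b) = 2 * (∑ a, ∑ b, if a < b then φ (a, b) else 0) := by
    have h3 : ∀ a b, φ (a, b) = (if a < b then φ (a, b) else 0) + if b < a then φ (b, a) else 0 := by
      intro a b
      rcases lt_trichotomy a b with h | rfl | h
      · simp [h, h.not_gt]
      · simp [φ]
      · simp only [h, h.not_gt, if_true, if_false, zero_add, φ]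
        ring
    rw [Finset.sum_congr rfl fun a _ => Finset.sum_congr rfl fun b _ => h3 a b]
    simp only [Finset.sum_add_distrib]
    rw [two_mul, add_right_inj, Finset.sum_comm]
  have h4 : ∑ a, ∑ b, φ (a, b) = 2 * (if i = j then (n : ℝ) else 0) - 2 := by
    have h5 : ∀ a b, φ (a, b) =
        δ i a * δ j a + δ i b * δ j b - δ i a * δ j b - δ i b * δ j a := fun a b => by
      simp only [φ]
      ring
    simp only [h5, Finset.sum_sub_distrib, Finset.sum_add_distrib, ← Finset.mul_sum,
      ← Finset.sum_mul]
    have h6 : ∀ i, ∑ a, δ i a = 1 := fun i => by simp [δ]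
    have h7 : ∑ a, δ i a * δ j a = if i = j then 1 else 0 := by simp [δ]
    have h8 : ∑ a, δ i a * (n * δ j a) = n * if i = j then 1 else 0 := by
      simp only [mul_left_comm _ (n : ℝ), ← Finset.mul_sum, h7]
    simp only [h6, h7, h8, Finset.sum_const, Finset.card_univ, Fintype.card_fin, nsmul_eq_mul]
    split_ifs <;> ring
  rw [Fintype.sum_option]
  have h8 : ∑ l : {ij : Fin n × Fin n // ij.1 < ij.2},
      sumDiffMatrix n (some l) i * sumDiffMatrix n (some l) j =
      ∑ l : {ij : Fin n × Fin n // ij.1 < ij.2}, φ l := rfl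
  rw [h8, h1]
  simp only [sumDiffMatrix]
  linarith

theorem sum_option_sumDiffMatrix_smul {E R : Type*} [AddCommGroup E] [Module ℂ E]
    [AddCommMonoid R] {n : ℕ} (A : Fin n → E) (F : E → R) :
    ∑ l, F (∑ i, (sumDiffMatrix n l i : ℂ) • A i) =
      F (∑ i, A i) + ∑ ij : Fin n × Fin n with ij.1 < ij.2, F (A ij.1 - A ij.2) := by
  rw [Fintype.sum_option, Finset.sum_subtype (p := fun ij : Fin n × Fin n => ij.1 < ij.2) _
    (by simp) fun ij => F (A ij.1 - A ij.2)]
  congr 1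
  · simp [sumDiffMatrix]
  · refine Finset.sum_congr rfl fun l _ => congrArg F ?_
    simp only [sumDiffMatrix]
    push_cast
    simp [sub_smul]

end SumDifference

theorem theorem1p4 {H : Type*} [NormedAddCommGroup H] [InnerProductSpace ℂ H] [CompleteSpace H]
    [TopologicalSpace.SeparableSpace H] (n : ℕ) (p q : ℝ) (hp : 0 < p) (hq : 0 < q)
    (hpq : 1 / p + 1 / q = 1) (A : Fin n → H →L[ℂ] H) (hA : ∀ i, A i ∈ schattenClass H p) :
    (1 < p → p ≤ 2 →
      schattenNorm p (∑ i, A i) ^ q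
          + ∑ ij : Fin n × Fin n with ij.1 < ij.2, schattenNorm p (A ij.1 - A ij.2) ^ q
        ≤ (n : ℝ≥0∞) * (∑ i, schattenNorm p (A i) ^ p) ^ (q / p)) ∧
    (2 ≤ p →
      (n : ℝ≥0∞) * (∑ i, schattenNorm p (A i) ^ p) ^ (q / p)
        ≤ schattenNorm p (∑ i, A i) ^ q
          + ∑ ij : Fin n × Fin n with ij.1 < ij.2, schattenNorm p (A ij.1 - A ij.2) ^ q) := by
  rw [← sum_option_sumDiffMatrix_smul A fun X => schattenNorm p X ^ q, ← ENNReal.ofReal_natCast]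
  exact ⟨fun hp1 hp2 => sum_schattenNorm_rpow_le n.cast_nonneg (abs_sumDiffMatrix_le n)
      (sum_sumDiffMatrix_mul n) hp1 hp2 hpq hq hA,
    fun hp2 => le_sum_schattenNorm_rpow n.cast_nonneg (abs_sumDiffMatrix_le n)
      (sum_sumDiffMatrix_mul n) hp2 hpq hq fun i => (hA i).1⟩
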